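/- Let $\ell$ be an odd prime and let $T$ be a nonzero integer with $\ell\mid T$. For $m\ge 1$ let $$G(m)=\{(g_1,g_2)\in \mathrm{GL}_2(\mathbb Z/m\mathbb Z)^2:\ \det g_1=\det g_2\},\qquad G(m,T)=\{(g_1,g_2)\in G(m):\ \operatorname{tr} g_1+\operatorname{tr} g_2\equiv T \bmod m\}.$$ Let $v=v_\ell(T)\ge 1$ be the $\ell$-adic valuation of $T$, let $e=e_\ell(T)=\lfloor (v-1)/2\rfloor$, let $\delta_2(v)=1$ if $v$ is even and $\delta_2(v)=0$ if $v$ is odd, and put $$E(\ell,T)=\frac{2\ell^3(\ell+1)(\ell^{4e+4}-1)+\ell^3(\ell^4+\ell^3+2\ell^2-\ell-1)(\ell^{4e}-1)}{(\ell^2+1)(\ell+1)},$$ a rational number whose denominator in lowest terms is prime to $\ell$. Then: 1. For every $n\ge v+1$, $$|G(\ell^n,T)|=(\ell-1)\,\ell^{6n-4e-9}\Bigl(\ell^{4e+3}(\ell^5-\ell^3-3\ell^2+1)+E(\ell,T)+\ell\,\delta_2(v)(\ell^3-1)\Bigr).$$ 2. $$\lim_{n\to\infty}\frac{\ell^n\,|G(\ell^n,T)|}{|G(\ell^n)|}=\frac{\ell^6-\ell^4-3\ell^3+\ell}{\ell^6-2\ell^4+\ell^2}+\frac{E(\ell,T)+\ell\,\delta_2(v)(\ell^3-1)}{\ell^{4e+4}(\ell^2-1)^2}.$$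 -/

import Mathlib

open Filter Topology

/-- The group `(GL₂ ×_det GL₂)(R)` of pairs of invertible matrices with equal determinants. -/
def GLTwoDet (R : Type*) [CommRing R] : Subgroup (GL (Fin 2) R × GL (Fin 2) R) where
  carrier := {g | g.1.val.det = g.2.val.det}
  one_mem' := rfl
  mul_mem' := by
    intro a b ha hb
    simp only [Set.mem_setOf_eq] at ha hb ⊢
    simp [Matrix.det_mul, ha, hb]
  inv_mem' := by
    intro a ha
    simp only [Set.mem_setOf_eq] at ha ⊢
    simp [Matrix.coe_units_inv, Matrix.det_nonsing_inv, ha]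

/-- `G(m) = (GL₂ ×_det GL₂)(ℤ/mℤ)`. -/
abbrev GMod (m : ℕ) : Type := GLTwoDet (ZMod m)

/-- `G(m, T)`: the pairs in `G(m)` whose traces sum to `T` modulo `m`. -/
def GModTrace (m : ℕ) (T : ℤ) : Set (GMod m) :=
  {g | g.val.1.val.trace + g.val.2.val.trace = (T : ZMod m)}

/-- `e_ℓ(T) = ⌊(v_ℓ(T) - 1) / 2⌋`, used only when `v_ℓ(T) ≥ 1`. -/
def eFloor (l : ℕ) (T : ℤ) : ℕ := (padicValInt l T - 1) / 2

/-- `δ_k(m)` is `1` if `k` divides `m`, and `0` otherwise. -/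
def deltaDvd (k m : ℕ) : ℕ := if k ∣ m then 1 else 0

/-- The quantity `E(ℓ, T)`. -/
def EQuot (l : ℕ) (T : ℤ) : ℚ :=
  (2 * (l : ℚ) ^ 3 * ((l : ℚ) + 1) * ((l : ℚ) ^ (4 * eFloor l T + 4) - 1)
    + (l : ℚ) ^ 3 * ((l : ℚ) ^ 4 + (l : ℚ) ^ 3 + 2 * (l : ℚ) ^ 2 - (l : ℚ) - 1)
      * ((l : ℚ) ^ (4 * eFloor l T) - 1))
  / (((l : ℚ) ^ 2 + 1) * ((l : ℚ) + 1))

/-! Over a finite local ring `R` in which `2` is invertible, a `2 × 2` matrix is its trace `t`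
together with a traceless part `v`, and `4 det = t ^ 2 - Q v` for a ternary quadratic form `Q`.
Pairs of matrices with equal determinants and traces `t`, `T - t` become pairs `(v, w)` with
`Q w = Q v + T (T - 2 t)` and `t ^ 2 - Q v` a unit. When `T` reduces to `0` in the residue field
`k`, so does the shift `T (T - 2 t)`.

If `t` reduces to `0`, the condition says that `Q v` is a unit, and the pairs are counted over `k`:
`Q` represents all units with the same reduction equally often, because an element reducing to `1`
is a square. If `t` is a unit, the same argument counts the pairs for which `t ^ 2 - Q v` is not a
unit, and these are removed from the total. The total depends on the shift only up to units, and a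
linear change of variables turns `Q w - Q v` into a dot product of two vectors of length three, so
the total is the number of representations of `T` by such a dot product. Over `ℤ / ℓ ^ n` that
number is found by sorting the first vector by its content. -/

section Fibers

theorem card_subtype_eq_sum_ite {α : Type*} [Fintype α] (P : α → Prop) [DecidablePred P] :
    Nat.card {a // P a} = ∑ a, if P a then 1 else 0 := by
  rw [Nat.card_eq_fintype_card, Fintype.card_subtype, Finset.card_filter]

theorem card_and_add_card_not_and {α : Type*} [Finite α] (P Q : α → Prop) :
    Nat.card {a // P a ∧ Q a} + Nat.card {a // ¬P a ∧ Q a} = Nat.card {a // Q a} := by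
  classical
  have := Fintype.ofFinite α
  simp only [card_subtype_eq_sum_ite, ← Finset.sum_add_distrib]
  exact Finset.sum_congr rfl fun a _ => by by_cases P a <;> simp [*]

theorem card_subtype_prod_eq_sum {α β : Type*} [Fintype α] [Finite β] (P : α → β → Prop) :
    Nat.card {x : α × β // P x.1 x.2} = ∑ a, Nat.card {b // P a b} := by
  rw [Nat.card_congr (Equiv.subtypeProdEquivSigmaSubtype P), Nat.card_sigma]

theorem card_subtype_prod_eq_mul {α β : Type*} [Finite α] [Finite β] {P : α → Prop}
    {Q : α → β → Prop} {c : ℕ} (hc : ∀ a, P a → Nat.card {b // Q a b} = c) :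
    Nat.card {x : α × β // P x.1 ∧ Q x.1 x.2} = Nat.card {a // P a} * c := by
  classical
  have := Fintype.ofFinite α
  rw [card_subtype_prod_eq_sum fun a b => P a ∧ Q a b, card_subtype_eq_sum_ite, Finset.sum_mul]
  refine Finset.sum_congr rfl fun a _ => ?_
  split_ifs with ha
  · simp only [ha, true_and, one_mul, hc a ha]
  · simp only [ha, false_and, zero_mul, Nat.card_of_isEmpty]

variable {A B : Type*} [AddGroup A] [AddGroup B]

theorem card_fiber_eq_card_ker (f : A →+ B) {b : B} (hb : b ∈ f.range) :
    Nat.card {a // f a = b} = Nat.card f.ker := by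
  obtain ⟨a₀, rfl⟩ := hb
  exact Nat.card_congr ((Equiv.subRight a₀).subtypeEquiv fun a => by
    simp [AddMonoidHom.mem_ker, sub_eq_zero])

theorem card_ker_mul_card_range (f : A →+ B) :
    Nat.card f.ker * Nat.card f.range = Nat.card A := by
  rw [← AddSubgroup.index_ker, AddSubgroup.card_mul_index]

theorem sum_comp_eq_card_ker_nsmul_sum [Fintype A] [Fintype B] {M : Type*} [AddCommMonoid M]
    {f : A →+ B} (hf : Function.Surjective f) (g : B → M) :
    ∑ a, g (f a) = Nat.card f.ker • ∑ b, g b := by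
  classical
  rw [← Fintype.sum_fiberwise f, Finset.smul_sum]
  refine Finset.sum_congr rfl fun b _ => ?_
  rw [← card_fiber_eq_card_ker f (hf b), Nat.card_eq_fintype_card]
  exact Finset.sum_eq_card_nsmul fun a _ => congrArg g a.2

theorem card_subtype_comp [Finite A] {f : A →+ B} (hf : Function.Surjective f) (P : B → Prop) :
    Nat.card {a // P (f a)} = Nat.card f.ker * Nat.card {b // P b} := by
  classical
  have := Fintype.ofFinite A
  have := Fintype.ofSurjective f hf
  rw [card_subtype_eq_sum_ite fun a => P (f a), card_subtype_eq_sum_ite P, ← smul_eq_mul,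
    ← sum_comp_eq_card_ker_nsmul_sum hf fun b => if P b then 1 else 0]

end Fibers

section Units

theorem card_units_eq_card_isUnit (M : Type*) [Monoid M] :
    Nat.card Mˣ = Nat.card {x : M // IsUnit x} :=
  Nat.card_congr (Equiv.ofInjective _ Units.val_injective)

variable {R S : Type*} [Ring R] [Ring S]

theorem card_eq_card_ker_mul_card {f : R →+* S} (hf : Function.Surjective f) :
    Nat.card R = Nat.card (RingHom.ker f) * Nat.card S := by
  rw [← card_ker_mul_card_range f.toAddMonoidHom, AddMonoidHom.range_eq_top.2 hf,
    AddSubgroup.card_top]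
  rfl

theorem card_units_eq_card_ker_mul [Finite R] {f : R →+* S} [IsLocalHom f]
    (hf : Function.Surjective f) :
    Nat.card Rˣ = Nat.card (RingHom.ker f) * Nat.card Sˣ := by
  rw [card_units_eq_card_isUnit, card_units_eq_card_isUnit]
  exact (Nat.card_congr (Equiv.subtypeEquivRight fun x => (isUnit_map_iff f x).symm)).trans
    (card_subtype_comp (f := f.toAddMonoidHom) hf IsUnit)

end Units

section GeneralLinear

theorem card_square_matrix (n S : Type*) [Finite n] :
    Nat.card (Matrix n n S) = Nat.card S ^ Nat.card n ^ 2 := by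
  rw [Matrix, Nat.card_fun, Nat.card_fun, ← pow_mul, sq]

variable {R k : Type*} [CommRing R] [Finite R] [Field k] {ρ : R →+* k}

theorem card_GL_eq_card_ker_pow_mul [IsLocalHom ρ] (hρ : Function.Surjective ρ) (n : Type*)
    [Fintype n] [DecidableEq n] :
    Nat.card (GL n R) = Nat.card (RingHom.ker ρ) ^ Nat.card n ^ 2 * Nat.card (GL n k) := by
  have := Finite.of_surjective ρ hρ
  have hsurj : Function.Surjective (ρ.mapMatrix (m := n)) := fun N =>
    ⟨N.map (Function.surjInv hρ), Matrix.ext fun i j => Function.surjInv_eq hρ _⟩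
  have hloc : IsLocalHom (ρ.mapMatrix (m := n)) := ⟨fun M hM => by
    rwa [Matrix.isUnit_iff_isUnit_det, ← RingHom.map_det, isUnit_map_iff,
      ← Matrix.isUnit_iff_isUnit_det] at hM⟩
  have hker : Nat.card (RingHom.ker (ρ.mapMatrix (m := n)))
      = Nat.card (RingHom.ker ρ) ^ Nat.card n ^ 2 := by
    have h := card_eq_card_ker_mul_card hsurj
    rw [card_square_matrix, card_square_matrix, card_eq_card_ker_mul_card hρ, mul_pow] at h
    exact (Nat.eq_of_mul_eq_mul_right (pow_pos Nat.card_pos _) h).symm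
  rw [Matrix.GeneralLinearGroup, card_units_eq_card_ker_mul hsurj, hker]

theorem card_GLTwoDet_mul_card_units (R : Type*) [CommRing R] :
    Nat.card (GLTwoDet R) * Nat.card Rˣ = Nat.card (GL (Fin 2) R) ^ 2 := by
  let det₂ : GL (Fin 2) R →* Rˣ := Matrix.GeneralLinearGroup.det
  let δ : GL (Fin 2) R × GL (Fin 2) R →* Rˣ :=
    det₂.comp (MonoidHom.fst _ _) / det₂.comp (MonoidHom.snd _ _)
  have hker : δ.ker = GLTwoDet R := by
    ext g
    simp [δ, det₂, MonoidHom.mem_ker, div_eq_one, Units.ext_iff, GLTwoDet]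
  have hδ : Function.Surjective δ := fun u => by
    obtain ⟨g, hg⟩ := Matrix.GeneralLinearGroup.det_surjective (n := Fin 2) u
    exact ⟨(g, 1), by simp [δ, det₂, hg]⟩
  rw [← hker, ← Subgroup.card_top (G := Rˣ), ← MonoidHom.range_eq_top.2 hδ, ← Subgroup.index_ker,
    Subgroup.card_mul_index, Nat.card_prod, sq]

theorem card_GLTwoDet [IsLocalHom ρ] (hρ : Function.Surjective ρ) :
    (Nat.card (GLTwoDet R) : ℤ)
      = (Nat.card (RingHom.ker ρ) : ℤ) ^ 7 * (Nat.card k : ℤ) ^ 2 * (Nat.card k - 1)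
        * ((Nat.card k : ℤ) ^ 2 - 1) ^ 2 := by
  have := Finite.of_surjective ρ hρ
  have := Fintype.ofFinite k
  have hq : 1 < Nat.card k := Finite.one_lt_card
  have hm : 0 < Nat.card (RingHom.ker ρ) := Nat.card_pos
  have hk : (Nat.card kˣ : ℤ) = Nat.card k - 1 := by rw [Nat.card_units, Nat.cast_pred (by omega)]
  have hGL : (Nat.card (GL (Fin 2) k) : ℤ)
      = ((Nat.card k : ℤ) ^ 2 - 1) * ((Nat.card k : ℤ) ^ 2 - Nat.card k) := by
    rw [Matrix.card_GL_field, ← Nat.card_eq_fintype_card, Fin.prod_univ_two, Fin.val_zero,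
      Fin.val_one, pow_zero, pow_one, Nat.cast_mul, Nat.cast_sub (Nat.one_le_pow 2 _ hq.le),
      Nat.cast_sub (Nat.le_self_pow two_ne_zero _), Nat.cast_pow, Nat.cast_one]
  have h := congrArg (Nat.cast : ℕ → ℤ) (card_GLTwoDet_mul_card_units R)
  rw [card_GL_eq_card_ker_pow_mul hρ, card_units_eq_card_ker_mul hρ, Nat.card_fin] at h
  push_cast [hk, hGL] at h
  refine mul_right_cancel₀ (mul_ne_zero (Nat.cast_ne_zero.2 hm.ne') (sub_ne_zero.2 ?_)) (h.trans ?_)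
  · exact_mod_cast hq.ne'
  · ring

end GeneralLinear

section QuadraticFibers

variable {R k : Type*} [CommRing R] [Field k] {ρ : R →+* k}

theorem exists_sq_eq_of_map_eq_one [Finite R] [IsLocalHom ρ] (hk : ringChar k ≠ 2) {z : R}
    (hz : ρ z = 1) : ∃ c, ρ c = 1 ∧ c ^ 2 = z := by
  let square : {c // ρ c = 1} → {c // ρ c = 1} :=
    fun c => ⟨c ^ 2, by rw [map_pow, c.2, one_pow]⟩
  have hinj : Function.Injective square := by
    rintro ⟨a, ha⟩ ⟨b, hb⟩ h
    have hab : (a + b) * (a - b) = 0 := by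
      rw [← sq_sub_sq, sub_eq_zero]
      exact congrArg Subtype.val h
    have hunit : IsUnit (a + b) := by
      rw [← isUnit_map_iff ρ, map_add, ha, hb, one_add_one_eq_two]
      exact (Ring.two_ne_zero hk).isUnit
    exact Subtype.ext (sub_eq_zero.1 (hunit.mul_right_eq_zero.1 hab))
  obtain ⟨c, hc⟩ := Finite.surjective_of_injective hinj ⟨z, hz⟩
  exact ⟨c, c.2, congrArg Subtype.val hc⟩

variable {V : Type*} [AddCommGroup V] [Module R V] {Q : V → R}

theorem card_fiber_unit_sq_mul (hQ : ∀ (c : R) (v : V), Q (c • v) = c ^ 2 * Q v) (u : Rˣ) (D : R) :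
    Nat.card {v // Q v = u ^ 2 * D} = Nat.card {v // Q v = D} :=
  (Nat.card_congr ((MulAction.toPerm u).subtypeEquiv fun v => by
    rw [MulAction.toPerm_apply, Units.smul_def, hQ, ← Units.val_pow_eq_pow_val,
      Units.mul_right_inj])).symm

theorem card_fiber_eq_of_map_eq [Finite R] [IsLocalHom ρ] (hk : ringChar k ≠ 2)
    (hQ : ∀ (c : R) (v : V), Q (c • v) = c ^ 2 * Q v) {D D' : R} (hD : ρ D ≠ 0)
    (hDD' : ρ D' = ρ D) : Nat.card {v // Q v = D'} = Nat.card {v // Q v = D} := by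
  obtain ⟨d, rfl⟩ : IsUnit D := (isUnit_map_iff ρ D).1 hD.isUnit
  have hz : ρ (D' * ↑d⁻¹) = 1 := by rw [map_mul, hDD', ← map_mul, Units.mul_inv, map_one]
  obtain ⟨c, hc, hcz⟩ := exists_sq_eq_of_map_eq_one hk hz
  obtain ⟨c, rfl⟩ : IsUnit c := (isUnit_map_iff ρ c).1 (hc ▸ isUnit_one)
  rw [← card_fiber_unit_sq_mul hQ c d, hcz, Units.inv_mul_cancel_right]

theorem card_fiber_mul_card_ker [Finite R] [IsLocalHom ρ] (hk : ringChar k ≠ 2)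
    [Finite V] {W : Type*} [AddCommGroup W] {π : V →+ W} (hπ : Function.Surjective π)
    (hQ : ∀ (c : R) (v : V), Q (c • v) = c ^ 2 * Q v) {Q' : W → k}
    (hQ' : ∀ v, Q' (π v) = ρ (Q v)) {D : R} (hD : ρ D ≠ 0) :
    Nat.card {v // Q v = D} * Nat.card (RingHom.ker ρ)
      = Nat.card π.ker * Nat.card {w // Q' w = ρ D} := by
  classical
  have := Fintype.ofFinite R
  have := Fintype.ofFinite V
  have hker : Nat.card (RingHom.ker ρ) = Nat.card {D' // ρ D' = ρ D} :=
    (card_fiber_eq_card_ker ρ.toAddMonoidHom ⟨D, rfl⟩).symm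
  have hmaps : ((Finset.univ.filter fun v => ρ (Q v) = ρ D : Finset V) : Set V).MapsTo Q
      ((Finset.univ.filter fun D' => ρ D' = ρ D : Finset R) : Set R) :=
    fun v hv => by simpa using hv
  rw [← card_subtype_comp hπ fun w => Q' w = ρ D, hker]
  simp only [hQ', Nat.card_eq_fintype_card, Fintype.card_subtype]
  rw [Finset.card_eq_sum_card_fiberwise hmaps, mul_comm, ← smul_eq_mul]
  refine (Finset.sum_eq_card_nsmul fun D' hD' => ?_).symm
  have hD' : ρ D' = ρ D := (Finset.mem_filter.1 hD').2
  have h := card_fiber_eq_of_map_eq hk hQ hD hD'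
  simp only [Nat.card_eq_fintype_card, Fintype.card_subtype] at h
  rw [← h, Finset.filter_filter]
  exact congrArg Finset.card (Finset.filter_congr fun v _ => ⟨And.right, fun hv => ⟨hv ▸ hD', hv⟩⟩)

end QuadraticFibers

section TracelessForm

/-- Minus the determinant of the traceless matrix `!![v.1, v.2.1; v.2.2, -v.1]`: what remains of the
determinant of a matrix once its trace is split off (see `four_mul_det`). -/
def tracelessForm {R : Type*} [CommRing R] (v : R × R × R) : R := v.1 ^ 2 + v.2.1 * v.2.2

theorem tracelessForm_smul {R : Type*} [CommRing R] (c : R) (v : R × R × R) :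
    tracelessForm (c • v) = c ^ 2 * tracelessForm v := by
  simp only [tracelessForm, Prod.smul_fst, Prod.smul_snd, smul_eq_mul]
  ring

section Field

variable {k : Type*} [Field k] [DecidableEq k]

theorem card_mul_eq [Finite k] (a : k) :
    Nat.card {p : k × k // p.1 * p.2 = a} = Nat.card k - 1 + if a = 0 then Nat.card k else 0 := by
  have := Fintype.ofFinite k
  have hzero : Nat.card {c : k // 0 * c = a} = if a = 0 then Nat.card k else 0 := by
    split_ifs with h
    · simp [h]
    · simp [Ne.symm h]
  have hne (b : k) (hb : b ∈ Finset.univ.erase 0) : Nat.card {c // b * c = a} = 1 := by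
    have hb : b ≠ 0 := Finset.ne_of_mem_erase hb
    simp only [mul_comm b, ← eq_div_iff hb, Nat.card_unique]
  rw [card_subtype_prod_eq_sum fun b c => b * c = a, ← Finset.sum_erase_add _ _ (Finset.mem_univ 0),
    hzero, Finset.sum_congr rfl hne]
  simp

theorem card_tracelessForm_eq [Fintype k] (hk : ringChar k ≠ 2) (D : k) :
    (Nat.card {v : k × k × k // tracelessForm v = D} : ℤ)
      = Nat.card k * (Nat.card k + quadraticChar k D) := by
  have hsqrts : (Nat.card {x // D - x ^ 2 = 0} : ℤ) = quadraticChar k D + 1 := by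
    rw [← quadraticChar_card_sqrts hk D, Set.toFinset_card, ← Nat.card_eq_fintype_card]
    exact congrArg _ (Nat.card_congr (Equiv.subtypeEquivRight fun x => by
      rw [sub_eq_zero, eq_comm]; rfl))
  have hpairs (x : k) : Nat.card {p : k × k // x ^ 2 + p.1 * p.2 = D}
      = Nat.card k - 1 + Nat.card k * if D - x ^ 2 = 0 then 1 else 0 := by
    simp only [mul_ite, mul_one, mul_zero, ← card_mul_eq, eq_sub_iff_add_eq']
  have hsum : Nat.card {v : k × k × k // tracelessForm v = D}
      = ∑ x, Nat.card {p : k × k // x ^ 2 + p.1 * p.2 = D} :=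
    card_subtype_prod_eq_sum fun (x : k) (p : k × k) => x ^ 2 + p.1 * p.2 = D
  simp only [hsum, hpairs, Finset.sum_add_distrib, ← Finset.mul_sum, ← card_subtype_eq_sum_ite,
    Finset.sum_const, Finset.card_univ, smul_eq_mul, ← Nat.card_eq_fintype_card, Nat.cast_add,
    Nat.cast_mul, Nat.cast_pred Nat.card_pos, hsqrts]
  ring

end Field

section Reduction

theorem card_ker_prodMap {A B C D : Type*} [AddGroup A] [AddGroup B] [AddGroup C] [AddGroup D]
    (f : A →+ B) (g : C →+ D) :
    Nat.card (f.prodMap g).ker = Nat.card f.ker * Nat.card g.ker := by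
  rw [AddMonoidHom.ker_prodMap, Nat.card_congr (AddSubgroup.prodEquiv _ _).toEquiv, Nat.card_prod]

variable {R k : Type*} [CommRing R]

/-- Coordinatewise reduction of triples, the map along which `tracelessForm` is compared over `R`
and over its residue field. -/
def mapTriple [Field k] (ρ : R →+* k) : R × R × R →+ k × k × k :=
  (ρ : R →+ k).prodMap ((ρ : R →+ k).prodMap (ρ : R →+ k))

variable [Field k] {ρ : R →+* k}

theorem card_ker_mapTriple : Nat.card (mapTriple ρ).ker = Nat.card (RingHom.ker ρ) ^ 3 := by
  rw [mapTriple, card_ker_prodMap, card_ker_prodMap, pow_succ', sq]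
  rfl

theorem mapTriple_surjective (hρ : Function.Surjective ρ) : Function.Surjective (mapTriple ρ) :=
  hρ.prodMap (hρ.prodMap hρ)

theorem tracelessForm_mapTriple (v : R × R × R) :
    tracelessForm (mapTriple ρ v) = ρ (tracelessForm v) := by
  simp only [tracelessForm, map_add, map_mul, map_pow]
  rfl

variable [Finite R] [IsLocalHom ρ]

theorem card_tracelessForm_eq_of_map_ne_zero [Fintype k] [DecidableEq k]
    (hρ : Function.Surjective ρ) (hk : ringChar k ≠ 2) {D : R} (hD : ρ D ≠ 0) :
    (Nat.card {v : R × R × R // tracelessForm v = D} : ℤ)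
      = Nat.card (RingHom.ker ρ) ^ 2 * (Nat.card k * (Nat.card k + quadraticChar k (ρ D))) := by
  have hκ : (Nat.card (RingHom.ker ρ) : ℤ) ≠ 0 := Nat.cast_ne_zero.2 Nat.card_pos.ne'
  have h := card_fiber_mul_card_ker hk (mapTriple_surjective hρ) tracelessForm_smul
    tracelessForm_mapTriple hD
  rw [card_ker_mapTriple] at h
  refine mul_right_cancel₀ hκ ?_
  rw [← card_tracelessForm_eq hk, ← Nat.cast_mul, h]
  push_cast
  ring

theorem card_tracelessForm_pairs [Fintype k] [DecidableEq k] (hρ : Function.Surjective ρ)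
    (hk : ringChar k ≠ 2) {s : R} (hs : ρ s = 0) {P : k → Prop} [DecidablePred P]
    (hP : ∀ a, P a → a ≠ 0) :
    (Nat.card {x : (R × R × R) × (R × R × R) //
        P (ρ (tracelessForm x.1)) ∧ tracelessForm x.2 = tracelessForm x.1 + s} : ℤ)
      = Nat.card (RingHom.ker ρ) ^ 5
        * ∑ a with P a, ((Nat.card k : ℤ) * (Nat.card k + quadraticChar k a)) ^ 2 := by
  have := Fintype.ofFinite R
  let N (a : k) : ℤ := Nat.card k * (Nat.card k + quadraticChar k a)
  let g (w : k × k × k) : ℤ := if P (tracelessForm w) then N (tracelessForm w) else 0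
  have hsecond (u : R × R × R) : (Nat.card {w : R × R × R //
      P (ρ (tracelessForm u)) ∧ tracelessForm w = tracelessForm u + s} : ℤ)
        = Nat.card (RingHom.ker ρ) ^ 2 * g (mapTriple ρ u) := by
    have hus : ρ (tracelessForm u + s) = ρ (tracelessForm u) := by rw [map_add, hs, add_zero]
    simp only [g, N, tracelessForm_mapTriple]
    split_ifs with h
    · simp only [h, true_and]
      rw [card_tracelessForm_eq_of_map_ne_zero hρ hk (hus ▸ hP _ h), hus]
    · simp [h]
  have hfirst : ∑ w, g w = ∑ a with P a, N a ^ 2 := by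
    rw [Finset.sum_filter, ← Finset.sum_fiberwise (g := tracelessForm)]
    refine Finset.sum_congr rfl fun a _ => ?_
    rw [Finset.sum_eq_card_nsmul (b := if P a then N a else 0)
      fun w hw => by simp only [g, (Finset.mem_filter.1 hw).2], ← Fintype.card_subtype,
      ← Nat.card_eq_fintype_card, nsmul_eq_mul, card_tracelessForm_eq hk, mul_ite, mul_zero, sq]
  rw [card_subtype_prod_eq_sum fun u w : R × R × R =>
      P (ρ (tracelessForm u)) ∧ tracelessForm w = tracelessForm u + s, Nat.cast_sum,
    Finset.sum_congr rfl fun u _ => hsecond u, ← Finset.mul_sum,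
    sum_comp_eq_card_ker_nsmul_sum (mapTriple_surjective hρ), hfirst, card_ker_mapTriple]
  simp only [nsmul_eq_mul, N]
  push_cast
  ring

theorem card_tracelessForm_pairs_map_ne_zero (hρ : Function.Surjective ρ) (hk : ringChar k ≠ 2)
    {s : R} (hs : ρ s = 0) :
    (Nat.card {x : (R × R × R) × (R × R × R) //
        ρ (tracelessForm x.1) ≠ 0 ∧ tracelessForm x.2 = tracelessForm x.1 + s} : ℤ)
      = Nat.card (RingHom.ker ρ) ^ 5
        * (Nat.card k ^ 2 * (Nat.card k - 1) * (Nat.card k ^ 2 + 1)) := by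
  classical
  have := Finite.of_surjective ρ hρ
  have := Fintype.ofFinite k
  have hterm (a : k) (ha : a ∈ Finset.univ.erase 0) :
      ((Nat.card k : ℤ) * (Nat.card k + quadraticChar k a)) ^ 2
        = Nat.card k ^ 2 * (Nat.card k ^ 2 + 1) + 2 * Nat.card k ^ 3 * quadraticChar k a := by
    linear_combination (Nat.card k : ℤ) ^ 2 * quadraticChar_sq_one (Finset.ne_of_mem_erase ha)
  have hchar : ∑ a ∈ Finset.univ.erase (0 : k), quadraticChar k a = 0 := by
    rw [← quadraticChar_sum_zero hk, ← Finset.sum_erase_add _ _ (Finset.mem_univ 0),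
      quadraticChar_zero, add_zero]
  rw [card_tracelessForm_pairs (P := (· ≠ 0)) hρ hk hs fun _ => id, Finset.filter_ne',
    Finset.sum_congr rfl hterm, Finset.sum_add_distrib, ← Finset.mul_sum, ← Finset.mul_sum, hchar,
    Finset.sum_const, Finset.card_erase_of_mem (Finset.mem_univ 0), Finset.card_univ,
    ← Nat.card_eq_fintype_card, nsmul_eq_mul, Nat.cast_pred Nat.card_pos]
  ring

theorem card_tracelessForm_pairs_map_eq_sq (hρ : Function.Surjective ρ) (hk : ringChar k ≠ 2)
    {s : R} (hs : ρ s = 0) {b : k} (hb : b ≠ 0) :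
    (Nat.card {x : (R × R × R) × (R × R × R) //
        ρ (tracelessForm x.1) = b ^ 2 ∧ tracelessForm x.2 = tracelessForm x.1 + s} : ℤ)
      = Nat.card (RingHom.ker ρ) ^ 5 * (Nat.card k ^ 2 * (Nat.card k + 1) ^ 2) := by
  have := Classical.decEq k
  have := Finite.of_surjective ρ hρ
  have := Fintype.ofFinite k
  rw [card_tracelessForm_pairs (P := (· = b ^ 2)) hρ hk hs fun a ha => ha ▸ pow_ne_zero 2 hb,
    Finset.filter_eq', if_pos (Finset.mem_univ _), Finset.sum_singleton, quadraticChar_sq_one' hb,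
    mul_pow]

end Reduction

end TracelessForm

section TraceSum

/-- The pairs in `GLTwoDet R` whose traces sum to `T`: the analogue of `GModTrace` over an arbitrary
commutative ring, so that `GModTrace m T` is `traceSumSet (ZMod m) T`. -/
def traceSumSet (R : Type*) [CommRing R] (T : R) : Set (GLTwoDet R) :=
  {g | g.val.1.val.trace + g.val.2.val.trace = T}

section Parametrization

variable {R : Type*} [CommRing R] [Invertible (2 : R)]

/-- A two-by-two matrix as its trace together with the coordinates of twice its traceless part,
normalized so that `4 * A.det` is the square of the first minus the `tracelessForm` of the second
(see `four_mul_det`). -/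
def traceCoords : Matrix (Fin 2) (Fin 2) R ≃ R × (R × R × R) where
  toFun A := (A.trace, A 0 0 - A 1 1, 2 * A 0 1, 2 * A 1 0)
  invFun x := !![⅟2 * (x.1 + x.2.1), ⅟2 * x.2.2.1; ⅟2 * x.2.2.2, ⅟2 * (x.1 - x.2.1)]
  left_inv A := by
    have h2 : (⅟2 : R) * 2 = 1 := invOf_mul_self 2
    ext i j
    fin_cases i <;> fin_cases j <;>
      simp only [Matrix.trace_fin_two, Matrix.of_apply, Matrix.cons_val, Fin.zero_eta, Fin.mk_one]
    · linear_combination A 0 0 * h2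
    · linear_combination A 0 1 * h2
    · linear_combination A 1 0 * h2
    · linear_combination A 1 1 * h2
  right_inv x := by
    have h2 : (⅟2 : R) * 2 = 1 := invOf_mul_self 2
    ext <;> simp only [Matrix.trace_fin_two, Matrix.of_apply, Matrix.cons_val]
    · linear_combination x.1 * h2
    · linear_combination x.2.1 * h2
    · linear_combination x.2.2.1 * h2
    · linear_combination x.2.2.2 * h2

theorem four_mul_det (A : Matrix (Fin 2) (Fin 2) R) :
    4 * A.det = (traceCoords A).1 ^ 2 - tracelessForm (traceCoords A).2 := by
  simp only [traceCoords, tracelessForm, Equiv.coe_fn_mk, Matrix.trace_fin_two,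
    Matrix.det_fin_two]
  ring

theorem isUnit_four : IsUnit (4 : R) := by
  have h := (isUnit_of_invertible (2 : R)).pow 2
  norm_num at h
  exact h

theorem isUnit_sq_sub_tracelessForm (g : GL (Fin 2) R) :
    IsUnit ((traceCoords g.val).1 ^ 2 - tracelessForm (traceCoords g.val).2) := by
  rw [← four_mul_det]
  exact isUnit_four.mul ((Matrix.isUnit_iff_isUnit_det _).1 g.isUnit)

theorem tracelessForm_snd_eq {T : R} {g : GLTwoDet R} (hg : g ∈ traceSumSet R T) :
    tracelessForm (traceCoords g.1.2.val).2
      = tracelessForm (traceCoords g.1.1.val).2 + T * (T - 2 * (traceCoords g.1.1.val).1) := by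
  have hdet : (4 : R) * g.1.1.val.det = 4 * g.1.2.val.det := congrArg _ g.2
  have hT : (traceCoords g.1.1.val).1 + (traceCoords g.1.2.val).1 = T := hg
  rw [four_mul_det, four_mul_det] at hdet
  linear_combination hdet + (T + (traceCoords g.1.2.val).1 - (traceCoords g.1.1.val).1) * hT

theorem exists_mem_traceSumSet {T t : R} {u w : R × R × R}
    (hunit : IsUnit (t ^ 2 - tracelessForm u))
    (hw : tracelessForm w = tracelessForm u + T * (T - 2 * t)) :
    ∃ g ∈ traceSumSet R T, traceCoords g.1.1.val = (t, u) ∧ traceCoords g.1.2.val = (T - t, w) := by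
  have hdet₁ : 4 * (traceCoords.symm (t, u)).det = t ^ 2 - tracelessForm u := by
    rw [four_mul_det, Equiv.apply_symm_apply]
  have hdet₂ : 4 * (traceCoords.symm (T - t, w)).det = t ^ 2 - tracelessForm u := by
    rw [four_mul_det, Equiv.apply_symm_apply]
    linear_combination -hw
  let g₁ := Matrix.GeneralLinearGroup.mk'' (traceCoords.symm (t, u))
    (isUnit_of_mul_isUnit_right (hdet₁ ▸ hunit))
  let g₂ := Matrix.GeneralLinearGroup.mk'' (traceCoords.symm (T - t, w))
    (isUnit_of_mul_isUnit_right (hdet₂ ▸ hunit))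
  have hdet : (g₁, g₂) ∈ GLTwoDet R := isUnit_four.mul_left_cancel (hdet₁.trans hdet₂.symm)
  refine ⟨⟨(g₁, g₂), hdet⟩, ?_, traceCoords.apply_symm_apply _,
    traceCoords.apply_symm_apply _⟩
  change (traceCoords (traceCoords.symm (t, u))).1
    + (traceCoords (traceCoords.symm (T - t, w))).1 = T
  simp only [Equiv.apply_symm_apply, add_sub_cancel]

theorem card_traceSumSet_eq_sum [Fintype R] (T : R) :
    Nat.card (traceSumSet R T) = ∑ t, Nat.card {x : (R × R × R) × (R × R × R) //
      IsUnit (t ^ 2 - tracelessForm x.1) ∧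
        tracelessForm x.2 = tracelessForm x.1 + T * (T - 2 * t)} := by
  rw [← card_subtype_prod_eq_sum fun (t : R) (x : (R × R × R) × (R × R × R)) =>
    IsUnit (t ^ 2 - tracelessForm x.1) ∧ tracelessForm x.2 = tracelessForm x.1 + T * (T - 2 * t)]
  refine Nat.card_eq_of_bijective
    (fun g => ⟨((traceCoords g.1.1.1.val).1, (traceCoords g.1.1.1.val).2,
      (traceCoords g.1.1.2.val).2), isUnit_sq_sub_tracelessForm _, tracelessForm_snd_eq g.2⟩)
    ⟨fun g h hgh => ?_, ?_⟩
  · obtain ⟨h₁, h₂, h₃⟩ :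
        (traceCoords g.1.1.1.val).1 = (traceCoords h.1.1.1.val).1 ∧
          (traceCoords g.1.1.1.val).2 = (traceCoords h.1.1.1.val).2 ∧
          (traceCoords g.1.1.2.val).2 = (traceCoords h.1.1.2.val).2 := by
      simpa only [Subtype.mk.injEq, Prod.mk.injEq] using hgh
    have htrace : (traceCoords g.1.1.2.val).1 = (traceCoords h.1.1.2.val).1 := by
      have hg : (traceCoords g.1.1.1.val).1 + (traceCoords g.1.1.2.val).1 = T := g.2
      have hh : (traceCoords h.1.1.1.val).1 + (traceCoords h.1.1.2.val).1 = T := h.2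
      linear_combination hg - hh - h₁
    exact Subtype.ext (Subtype.ext (Prod.ext
      (Units.ext (traceCoords.injective (Prod.ext h₁ h₂)))
      (Units.ext (traceCoords.injective (Prod.ext htrace h₃)))))
  · rintro ⟨⟨t, u, w⟩, hunit, hw⟩
    obtain ⟨g, hg, h₁, h₂⟩ := exists_mem_traceSumSet hunit hw
    exact ⟨⟨g, hg⟩, Subtype.ext (by simp only [h₁, h₂])⟩

end Parametrization

/-- The number of pairs of vectors with dot product `s`. By a linear change of variables, the
count over `Fin 3` is the number of pairs of triples whose `tracelessForm`s differ by `s`. -/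
noncomputable def dotProductCount (n R : Type*) [Fintype n] [CommRing R] (s : R) : ℕ :=
  Nat.card {x : (n → R) × (n → R) // x.1 ⬝ᵥ x.2 = s}

theorem dotProductCount_unit_mul {n R : Type*} [Fintype n] [CommRing R] (c : Rˣ) (s : R) :
    dotProductCount n R (c * s) = dotProductCount n R s :=
  (Nat.card_congr (((MulAction.toPerm c).prodCongr (Equiv.refl _)).subtypeEquiv fun x => by
    simp [Units.smul_def])).symm

theorem card_tracelessForm_pairs_eq_dotProductCount {R : Type*} [CommRing R] [Invertible (2 : R)]
    (s : R) :
    Nat.card {x : (R × R × R) × (R × R × R) // tracelessForm x.2 = tracelessForm x.1 + s}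
      = dotProductCount (Fin 3) R s := by
  have h2 : (⅟2 : R) * 2 = 1 := invOf_mul_self 2
  let coords : (R × R × R) × (R × R × R) ≃ (Fin 3 → R) × (Fin 3 → R) :=
    { toFun := fun x =>
        (![x.2.1 - x.1.1, x.2.2.1, -x.1.2.1], ![x.2.1 + x.1.1, x.2.2.2, x.1.2.2])
      invFun := fun y =>
        ((⅟2 * (y.2 0 - y.1 0), -y.1 2, y.2 2), ⅟2 * (y.2 0 + y.1 0), y.1 1, y.2 1)
      left_inv := fun x => by
        ext <;> simp only [Matrix.cons_val, neg_neg]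
        · linear_combination x.1.1 * h2
        · linear_combination x.2.1 * h2
      right_inv := fun y => by
        ext i <;> fin_cases i <;>
          simp only [Matrix.cons_val, neg_neg, Fin.zero_eta, Fin.mk_one, Fin.reduceFinMk]
        · linear_combination y.1 0 * h2
        · linear_combination y.2 0 * h2 }
  refine Nat.card_congr (coords.subtypeEquiv fun x => ?_)
  rw [← sub_eq_iff_eq_add']
  simp only [coords, tracelessForm, Equiv.coe_fn_mk, dotProduct, Fin.sum_univ_three,
    Matrix.cons_val]
  ring_nf

section LocalFormula

variable {R k : Type*} [CommRing R] [Finite R] [Field k] {ρ : R →+* k} [IsLocalHom ρ]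

theorem card_traceSum_fiber_of_map_eq_zero (hρ : Function.Surjective ρ) (hk : ringChar k ≠ 2)
    {s t : R} (hs : ρ s = 0) (ht : ρ t = 0) :
    (Nat.card {x : (R × R × R) × (R × R × R) //
        IsUnit (t ^ 2 - tracelessForm x.1) ∧ tracelessForm x.2 = tracelessForm x.1 + s} : ℤ)
      = Nat.card (RingHom.ker ρ) ^ 5
        * (Nat.card k ^ 2 * (Nat.card k - 1) * (Nat.card k ^ 2 + 1)) := by
  have hunit (u : R × R × R) :
      IsUnit (t ^ 2 - tracelessForm u) ↔ ρ (tracelessForm u) ≠ 0 := by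
    rw [← isUnit_map_iff ρ, isUnit_iff_ne_zero, map_sub, map_pow, ht, zero_pow two_ne_zero,
      zero_sub, neg_ne_zero]
  simp only [hunit]
  exact card_tracelessForm_pairs_map_ne_zero hρ hk hs

theorem card_traceSum_fiber_of_map_ne_zero [Invertible (2 : R)] (hρ : Function.Surjective ρ)
    (hk : ringChar k ≠ 2) {T t : R} (hT : ρ T = 0) (ht : ρ t ≠ 0) :
    (Nat.card {x : (R × R × R) × (R × R × R) // IsUnit (t ^ 2 - tracelessForm x.1) ∧
        tracelessForm x.2 = tracelessForm x.1 + T * (T - 2 * t)} : ℤ)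
      = dotProductCount (Fin 3) R T
        - Nat.card (RingHom.ker ρ) ^ 5 * (Nat.card k ^ 2 * (Nat.card k + 1) ^ 2) := by
  have hunit (u : R × R × R) :
      IsUnit (t ^ 2 - tracelessForm u) ↔ ¬ρ (tracelessForm u) = ρ t ^ 2 := by
    rw [← isUnit_map_iff ρ, isUnit_iff_ne_zero, map_sub, map_pow, sub_ne_zero, ne_comm]
  have hs : ρ (T * (T - 2 * t)) = 0 := by rw [map_mul, hT, zero_mul]
  obtain ⟨c, hc⟩ : IsUnit (T - 2 * t) := by
    rw [← isUnit_map_iff ρ, map_sub, hT, zero_sub, IsUnit.neg_iff, map_mul]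
    exact ((isUnit_of_invertible 2).map ρ).mul ht.isUnit
  have hdot : dotProductCount (Fin 3) R (T * (T - 2 * t)) = dotProductCount (Fin 3) R T := by
    rw [← hc, mul_comm, dotProductCount_unit_mul]
  simp only [hunit]
  rw [← card_tracelessForm_pairs_map_eq_sq hρ hk hs ht, eq_sub_iff_add_eq', ← Nat.cast_add,
    card_and_add_card_not_and, card_tracelessForm_pairs_eq_dotProductCount, hdot]

theorem card_traceSumSet (hρ : Function.Surjective ρ) (hk : ringChar k ≠ 2) {T : R}
    (hT : ρ T = 0) :
    (Nat.card (traceSumSet R T) : ℤ)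
      = Nat.card (RingHom.ker ρ) ^ 6 * (Nat.card k ^ 2 * (Nat.card k - 1) * (Nat.card k ^ 2 + 1))
        + Nat.card (RingHom.ker ρ) * (Nat.card k - 1)
          * (dotProductCount (Fin 3) R T
            - Nat.card (RingHom.ker ρ) ^ 5 * (Nat.card k ^ 2 * (Nat.card k + 1) ^ 2)) := by
  have := Classical.decEq k
  have := Fintype.ofFinite R
  have := Fintype.ofSurjective ρ hρ
  have h2 : IsUnit (ρ 2) := by rw [map_ofNat]; exact (Ring.two_ne_zero hk).isUnit
  have := ((isUnit_map_iff ρ 2).1 h2).invertible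
  set κ : ℤ := (Nat.card (RingHom.ker ρ) : ℤ)
  set q : ℤ := (Nat.card k : ℤ) with hq
  let g (a : k) : ℤ := if a = 0 then κ ^ 5 * (q ^ 2 * (q - 1) * (q ^ 2 + 1))
    else dotProductCount (Fin 3) R T - κ ^ 5 * (q ^ 2 * (q + 1) ^ 2)
  have hfiber (t : R) : (Nat.card {x : (R × R × R) × (R × R × R) //
      IsUnit (t ^ 2 - tracelessForm x.1) ∧
        tracelessForm x.2 = tracelessForm x.1 + T * (T - 2 * t)} : ℤ) = g (ρ t) := by
    simp only [g]
    split_ifs with ht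
    · exact card_traceSum_fiber_of_map_eq_zero hρ hk (by rw [map_mul, hT, zero_mul]) ht
    · exact card_traceSum_fiber_of_map_ne_zero hρ hk hT ht
  have hsum : ∑ t, g (ρ t) = κ * ∑ a, g a := by
    rw [← nsmul_eq_mul]
    exact sum_comp_eq_card_ker_nsmul_sum (f := ρ.toAddMonoidHom) hρ g
  rw [card_traceSumSet_eq_sum, Nat.cast_sum, Finset.sum_congr rfl fun t _ => hfiber t, hsum]
  simp only [g, Finset.sum_ite, Finset.filter_eq', Finset.filter_ne', Finset.mem_univ, if_true,
    Finset.card_singleton, Nat.cast_one, Finset.sum_const, Finset.card_erase_of_mem,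
    Finset.card_univ, ← Nat.card_eq_fintype_card, nsmul_eq_mul, Nat.cast_pred Nat.card_pos, ← hq]
  ring

end LocalFormula

end TraceSum

section DotProduct

theorem card_dotProduct_fiber_mul_card_span {ι R : Type*} [Fintype ι] [CommRing R] {u : ι → R}
    {s : R} (hs : s ∈ Ideal.span (Set.range u)) :
    Nat.card {w : ι → R // u ⬝ᵥ w = s} * Nat.card (Ideal.span (Set.range u))
      = Nat.card R ^ Nat.card ι := by
  let f : (ι → R) →+ R := (Fintype.linearCombination R u).toAddMonoidHom
  have hf (w : ι → R) : f w = u ⬝ᵥ w := dotProduct_comm w u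
  have hrange : f.range = (Ideal.span (Set.range u)).toAddSubgroup := by
    rw [Ideal.span, ← Fintype.range_linearCombination]
    rfl
  have hfiber := card_fiber_eq_card_ker f (b := s) (hrange ▸ hs)
  simp only [hf] at hfiber
  have h := card_ker_mul_card_range f
  rwa [hrange, ← hfiber, Nat.card_fun] at h

variable {p n j : ℕ}

/-- The part of `dotProductCount` coming from first vectors whose content is divisible by
`p ^ j`; it interpolates between the full count at `j = 0` and the empty count at
`j = v(s) + 1`. -/
noncomputable def dvdDotProductCount (p n d j : ℕ) (s : ZMod (p ^ n)) : ℕ :=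
  Nat.card {x : (Fin (d + 1) → ZMod (p ^ n)) × (Fin (d + 1) → ZMod (p ^ n)) //
    (∀ i, (p : ZMod (p ^ n)) ^ j ∣ x.1 i) ∧ x.1 ⬝ᵥ x.2 = s}

theorem dvdDotProductCount_zero (d : ℕ) (s : ZMod (p ^ n)) :
    dvdDotProductCount p n d 0 s = dotProductCount (Fin (d + 1)) (ZMod (p ^ n)) s := by
  simp only [dvdDotProductCount, dotProductCount, pow_zero, isUnit_one, IsUnit.dvd, implies_true,
    true_and]

theorem dvdDotProductCount_eq_zero (d : ℕ) {s : ZMod (p ^ n)}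
    (hs : ¬(p : ZMod (p ^ n)) ^ j ∣ s) : dvdDotProductCount p n d j s = 0 := by
  have : IsEmpty {x : (Fin (d + 1) → ZMod (p ^ n)) × (Fin (d + 1) → ZMod (p ^ n)) //
      (∀ i, (p : ZMod (p ^ n)) ^ j ∣ x.1 i) ∧ x.1 ⬝ᵥ x.2 = s} :=
    ⟨fun x => hs (x.2.2 ▸ Finset.dvd_sum fun i _ => (x.2.1 i).mul_right _)⟩
  exact Nat.card_of_isEmpty

variable [Fact p.Prime]

theorem isUnit_of_not_prime_dvd {x : ZMod (p ^ n)} (hx : ¬(p : ZMod (p ^ n)) ∣ x) : IsUnit x := by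
  have hp : p.Prime := Fact.out
  have : NeZero (p ^ n) := ⟨pow_ne_zero _ hp.ne_zero⟩
  obtain ⟨m, rfl⟩ := ZMod.natCast_zmod_surjective x
  rw [ZMod.isUnit_iff_coprime]
  exact ((hp.coprime_iff_not_dvd.2 fun h => hx (Nat.cast_dvd_cast h)).symm).pow_right n

theorem card_pow_dvd (hj : j ≤ n) :
    Nat.card {x : ZMod (p ^ n) // (p : ZMod (p ^ n)) ^ j ∣ x} = p ^ (n - j) := by
  have hp : p.Prime := Fact.out
  have hmem (x : ZMod (p ^ n)) : (p : ZMod (p ^ n)) ^ j ∣ x ↔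
      x ∈ AddSubgroup.zmultiples ((p ^ j : ℕ) : ZMod (p ^ n)) := by
    rw [AddSubgroup.mem_zmultiples_iff]
    constructor
    · rintro ⟨y, rfl⟩
      obtain ⟨m, rfl⟩ := ZMod.intCast_surjective y
      exact ⟨m, by simp [mul_comm]⟩
    · rintro ⟨m, rfl⟩
      exact ⟨m, by simp [mul_comm]⟩
  rw [Nat.card_congr (Equiv.subtypeEquivRight hmem), Nat.card_zmultiples,
    ZMod.addOrderOf_coe _ (pow_ne_zero _ hp.ne_zero), Nat.gcd_eq_right (pow_dvd_pow p hj),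
    Nat.pow_div hj hp.pos]

theorem card_forall_pow_dvd (hj : j ≤ n) (ι : Type*) [Fintype ι] :
    Nat.card {u : ι → ZMod (p ^ n) // ∀ i, (p : ZMod (p ^ n)) ^ j ∣ u i}
      = (p ^ (n - j)) ^ Fintype.card ι := by
  rw [Nat.card_congr (Equiv.subtypePiEquivPi (p := fun _ x => (p : ZMod (p ^ n)) ^ j ∣ x)),
    Nat.card_pi, Finset.prod_const, card_pow_dvd hj, Finset.card_univ]

theorem span_range_eq_span_pow {ι : Type*} {u : ι → ZMod (p ^ n)}
    (hu : ∀ i, (p : ZMod (p ^ n)) ^ j ∣ u i) (hu' : ¬∀ i, (p : ZMod (p ^ n)) ^ (j + 1) ∣ u i) :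
    Ideal.span (Set.range u) = Ideal.span {(p : ZMod (p ^ n)) ^ j} := by
  refine le_antisymm (Ideal.span_le.2 ?_) ((Ideal.span_singleton_le_iff_mem _).2 ?_)
  · rintro _ ⟨i, rfl⟩
    exact Ideal.mem_span_singleton.2 (hu i)
  · obtain ⟨i, hi⟩ := not_forall.1 hu'
    obtain ⟨z, hz⟩ := hu i
    have hzu : IsUnit z := isUnit_of_not_prime_dvd fun ⟨t, ht⟩ =>
      hi ⟨t, by rw [hz, ht, pow_succ, mul_assoc]⟩
    exact (Ideal.mul_unit_mem_iff_mem _ hzu).1 (hz ▸ Ideal.subset_span ⟨i, rfl⟩)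

theorem card_dotProduct_fiber {d : ℕ} (hj : j ≤ n) {s : ZMod (p ^ n)}
    (hs : (p : ZMod (p ^ n)) ^ j ∣ s) {u : Fin (d + 1) → ZMod (p ^ n)}
    (hu : ∀ i, (p : ZMod (p ^ n)) ^ j ∣ u i) (hu' : ¬∀ i, (p : ZMod (p ^ n)) ^ (j + 1) ∣ u i) :
    Nat.card {w // u ⬝ᵥ w = s} = p ^ (d * n + j) := by
  have hspan := span_range_eq_span_pow hu hu'
  have hcard : Nat.card (Ideal.span (Set.range u)) = p ^ (n - j) := by
    rw [hspan, ← card_pow_dvd hj]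
    exact Nat.card_congr (Equiv.subtypeEquivRight fun _ => Ideal.mem_span_singleton)
  have h := card_dotProduct_fiber_mul_card_span (hspan ▸ Ideal.mem_span_singleton.2 hs)
  rw [hcard, Nat.card_zmod, Nat.card_fin] at h
  refine Nat.eq_of_mul_eq_mul_right (pow_pos (Fact.out : p.Prime).pos _) (h.trans ?_)
  rw [← pow_mul, ← pow_add]
  congr 1
  have := Nat.add_sub_cancel' hj
  nlinarith

theorem dvdDotProductCount_eq_add (d : ℕ) (hj : j < n) {s : ZMod (p ^ n)}
    (hs : (p : ZMod (p ^ n)) ^ j ∣ s) :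
    (dvdDotProductCount p n d j s : ℤ) = dvdDotProductCount p n d (j + 1) s
      + ((p ^ (n - j)) ^ (d + 1) - (p ^ (n - (j + 1))) ^ (d + 1)) * p ^ (d * n + j) := by
  have : NeZero (p ^ n) := ⟨pow_ne_zero _ (Fact.out : p.Prime).ne_zero⟩
  let D (j : ℕ) (u : Fin (d + 1) → ZMod (p ^ n)) : Prop := ∀ i, (p : ZMod (p ^ n)) ^ j ∣ u i
  have hD (u) : D (j + 1) u ∧ D j u ↔ D (j + 1) u :=
    and_iff_left_of_imp fun h i => (pow_dvd_pow _ j.le_succ).trans (h i)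
  have hcontent := card_subtype_prod_eq_mul (P := fun u => ¬D (j + 1) u ∧ D j u)
    fun u hu => card_dotProduct_fiber hj.le hs hu.2 hu.1
  have hvec := card_and_add_card_not_and (D (j + 1)) (D j)
  have hpairs := card_and_add_card_not_and
    (fun x : (Fin (d + 1) → ZMod (p ^ n)) × (Fin (d + 1) → ZMod (p ^ n)) => D (j + 1) x.1)
    (fun x => D j x.1 ∧ x.1 ⬝ᵥ x.2 = s)
  simp only [← and_assoc, hD] at hvec hpairs
  rw [hcontent] at hpairs
  rw [card_forall_pow_dvd hj.le, card_forall_pow_dvd hj, Fintype.card_fin] at hvec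
  zify at hvec hpairs
  rw [dvdDotProductCount, dvdDotProductCount, ← hpairs, ← hvec, add_sub_cancel_left]

theorem dvdDotProductCount_mul_pow (d : ℕ) {v : ℕ} (hv : v < n) {s : ZMod (p ^ n)}
    (hs : (p : ZMod (p ^ n)) ^ v ∣ s) (hs' : ¬(p : ZMod (p ^ n)) ^ (v + 1) ∣ s) (i : ℕ)
    (hji : j + i = v + 1) :
    (dvdDotProductCount p n d j s : ℤ) * p ^ (d * v + d + 1)
      = p ^ ((2 * d + 1) * n) * (p ^ (d + 1) - 1) * ∑ k ∈ Finset.range i, ((p : ℤ) ^ d) ^ k := by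
  induction i generalizing j with
  | zero =>
    obtain rfl : j = v + 1 := hji
    simp [dvdDotProductCount_eq_zero d hs']
  | succ i ih =>
    obtain rfl : v = j + i := by omega
    obtain ⟨m, rfl⟩ : ∃ m, n = m + (j + 1) := ⟨n - (j + 1), by omega⟩
    rw [dvdDotProductCount_eq_add d (by omega) ((pow_dvd_pow _ (by omega)).trans hs), add_mul,
      ih (by omega), Finset.sum_range_succ, mul_add, Nat.add_sub_cancel,
      show m + (j + 1) - j = m + 1 by omega]
    ring

theorem dotProductCount_mul_pow (d : ℕ) {v : ℕ} (hv : v < n) {s : ZMod (p ^ n)}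
    (hs : (p : ZMod (p ^ n)) ^ v ∣ s) (hs' : ¬(p : ZMod (p ^ n)) ^ (v + 1) ∣ s) :
    (dotProductCount (Fin (d + 1)) (ZMod (p ^ n)) s : ℤ) * p ^ (d * v + d + 1)
      = p ^ ((2 * d + 1) * n) * (p ^ (d + 1) - 1)
        * ∑ k ∈ Finset.range (v + 1), ((p : ℤ) ^ d) ^ k := by
  rw [← dvdDotProductCount_zero]
  exact dvdDotProductCount_mul_pow d hv hs hs' (v + 1) (zero_add _)

end DotProduct

section PrimePower

variable {p n : ℕ}

theorem pow_padicValInt_dvd_cast (T : ℤ) :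
    (p : ZMod (p ^ n)) ^ padicValInt p T ∣ (T : ZMod (p ^ n)) := by
  simpa using Int.cast_dvd_cast (α := ZMod (p ^ n)) _ _ (padicValInt_dvd (p := p) T)

variable [Fact p.Prime]

theorem isLocalHom_castHom_prime (hn : n ≠ 0) :
    IsLocalHom (ZMod.castHom (dvd_pow_self p hn) (ZMod p)) := by
  refine ⟨fun x hx => isUnit_of_not_prime_dvd ?_⟩
  rintro ⟨y, rfl⟩
  rw [map_mul, map_natCast, ZMod.natCast_self, zero_mul] at hx
  exact not_isUnit_zero hx

theorem card_ker_castHom_prime (hn : n ≠ 0) :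
    Nat.card (RingHom.ker (ZMod.castHom (dvd_pow_self p hn) (ZMod p))) = p ^ (n - 1) := by
  have h := card_eq_card_ker_mul_card (ZMod.castHom_surjective (dvd_pow_self p hn))
  rw [Nat.card_zmod, Nat.card_zmod] at h
  exact Nat.eq_of_mul_eq_mul_right (Fact.out : p.Prime).pos
    (h.symm.trans (pow_sub_one_mul hn p).symm)

theorem card_GMod_prime_pow (hn : n ≠ 0) :
    (Nat.card (GMod (p ^ n)) : ℤ)
      = (p : ℤ) ^ (7 * (n - 1)) * p ^ 2 * (p - 1) * ((p : ℤ) ^ 2 - 1) ^ 2 := by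
  have : NeZero (p ^ n) := ⟨pow_ne_zero _ (Fact.out : p.Prime).ne_zero⟩
  have := isLocalHom_castHom_prime (p := p) hn
  rw [card_GLTwoDet (ZMod.castHom_surjective (dvd_pow_self p hn)), card_ker_castHom_prime hn,
    Nat.card_zmod, Nat.cast_pow, ← pow_mul, mul_comm (n - 1)]

theorem not_pow_succ_padicValInt_dvd_cast {T : ℤ} (hT : T ≠ 0) (hn : padicValInt p T < n) :
    ¬(p : ZMod (p ^ n)) ^ (padicValInt p T + 1) ∣ (T : ZMod (p ^ n)) := by
  intro hd
  have h := map_dvd (ZMod.castHom (pow_dvd_pow p hn) (ZMod (p ^ (padicValInt p T + 1)))) hd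
  rw [map_pow, map_natCast, map_intCast, ← Nat.cast_pow, ZMod.natCast_self, zero_dvd_iff,
    ZMod.intCast_zmod_eq_zero_iff_dvd, Nat.cast_pow, padicValInt_dvd_iff] at h
  exact h.elim hT (Nat.not_succ_le_self _)

theorem dotProductCount_prime_pow {T : ℤ} (hT : T ≠ 0) (hn : padicValInt p T < n) :
    (dotProductCount (Fin 3) (ZMod (p ^ n)) T : ℚ)
      = (p : ℚ) ^ (5 * n) * ((p : ℚ) ^ 3 - 1) * ((p : ℚ) ^ (2 * padicValInt p T + 2) - 1)
        / ((p : ℚ) ^ (2 * padicValInt p T + 3) * ((p : ℚ) ^ 2 - 1)) := by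
  have hp : (1 : ℚ) < p := by exact_mod_cast (Fact.out : p.Prime).one_lt
  have hden : (p : ℚ) ^ (2 * padicValInt p T + 3) * ((p : ℚ) ^ 2 - 1) ≠ 0 :=
    mul_ne_zero (by positivity) (sub_pos.2 (one_lt_pow₀ hp two_ne_zero)).ne'
  have hcount := congrArg (Int.cast : ℤ → ℚ) (dotProductCount_mul_pow 2 hn
    (pow_padicValInt_dvd_cast T) (not_pow_succ_padicValInt_dvd_cast hT hn))
  have hgeom := geom_sum_mul ((p : ℚ) ^ 2) (padicValInt p T + 1)
  push_cast at hcount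
  rw [eq_div_iff hden, ← mul_assoc, hcount, mul_assoc, hgeom, ← pow_mul, mul_add_one]

theorem card_GModTrace_prime_pow (hp2 : p ≠ 2) {T : ℤ} (hT : T ≠ 0) (hpT : (p : ℤ) ∣ T)
    (hn : padicValInt p T < n) :
    (Nat.card (GModTrace (p ^ n) T) : ℚ)
      = (p : ℚ) ^ (6 * (n - 1)) * (p ^ 2 * (p - 1) * ((p : ℚ) ^ 2 + 1))
        + (p : ℚ) ^ (n - 1) * (p - 1)
          * ((p : ℚ) ^ (5 * n) * ((p : ℚ) ^ 3 - 1) * ((p : ℚ) ^ (2 * padicValInt p T + 2) - 1)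
              / ((p : ℚ) ^ (2 * padicValInt p T + 3) * ((p : ℚ) ^ 2 - 1))
            - (p : ℚ) ^ (5 * (n - 1)) * (p ^ 2 * ((p : ℚ) + 1) ^ 2)) := by
  have : NeZero (p ^ n) := ⟨pow_ne_zero _ (Fact.out : p.Prime).ne_zero⟩
  have hn0 : n ≠ 0 := Nat.ne_zero_of_lt hn
  have := isLocalHom_castHom_prime (p := p) hn0
  have hk : ringChar (ZMod p) ≠ 2 := by rwa [ZMod.ringChar_zmod_n]
  have hT0 : ZMod.castHom (dvd_pow_self p hn0) (ZMod p) T = 0 := by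
    rwa [map_intCast, ZMod.intCast_zmod_eq_zero_iff_dvd]
  have h := congrArg (Int.cast : ℤ → ℚ) (card_traceSumSet (ZMod.castHom_surjective _) hk hT0)
  rw [card_ker_castHom_prime hn0, Nat.card_zmod] at h
  push_cast [dotProductCount_prime_pow hT hn, ← pow_mul, mul_comm (n - 1)] at h
  exact h

end PrimePower

section ClosedForms

variable {l : ℕ} {T : ℤ}

theorem padicValInt_eq_of_dvd (hl : l.Prime) (hT : T ≠ 0) (hlT : (l : ℤ) ∣ T) :
    padicValInt l T = 2 * eFloor l T + 1 ∧ deltaDvd 2 (padicValInt l T) = 0 ∨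
      padicValInt l T = 2 * eFloor l T + 2 ∧ deltaDvd 2 (padicValInt l T) = 1 := by
  have : Fact l.Prime := ⟨hl⟩
  have hv : 1 ≤ padicValInt l T :=
    ((padicValInt_dvd_iff 1 T).1 (by rwa [pow_one])).resolve_left hT
  simp only [eFloor, deltaDvd]
  split_ifs <;> omega

theorem zpow_six_mul_sub_eq_div (hl : l ≠ 0) (m e : ℕ) :
    (l : ℚ) ^ (6 * ((m + 1 : ℕ) : ℤ) - 4 * (e : ℤ) - 9)
      = (l : ℚ) ^ (6 * m) / (l : ℚ) ^ (4 * e + 3) := by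
  rw [← zpow_natCast, ← zpow_natCast, ← zpow_sub₀ (Nat.cast_ne_zero.2 hl)]
  congr 1
  push_cast
  ring

theorem card_GModTrace (hl : l.Prime) (hl2 : l ≠ 2) (hT : T ≠ 0) (hlT : (l : ℤ) ∣ T) {n : ℕ}
    (hn : padicValInt l T < n) :
    (Nat.card (GModTrace (l ^ n) T) : ℚ)
      = ((l : ℚ) - 1) * (l : ℚ) ^ (6 * (n : ℤ) - 4 * (eFloor l T : ℤ) - 9)
        * ((l : ℚ) ^ (4 * eFloor l T + 3) * ((l : ℚ) ^ 5 - (l : ℚ) ^ 3 - 3 * (l : ℚ) ^ 2 + 1)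
          + EQuot l T + (l : ℚ) * (deltaDvd 2 (padicValInt l T) : ℚ) * ((l : ℚ) ^ 3 - 1)) := by
  have : Fact l.Prime := ⟨hl⟩
  have hl0 : (0 : ℚ) < l := by exact_mod_cast hl.pos
  have hm1 : (l : ℚ) - 1 ≠ 0 := sub_ne_zero.2 (by exact_mod_cast hl.one_lt.ne')
  have hsq : (l : ℚ) ^ 2 - 1 = (l - 1) * (l + 1) := by ring
  obtain ⟨m, rfl⟩ : ∃ m, n = m + 1 := Nat.exists_eq_succ_of_ne_zero (Nat.ne_zero_of_lt hn)
  rw [card_GModTrace_prime_pow hl2 hT hlT hn, EQuot, zpow_six_mul_sub_eq_div hl.ne_zero,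
    Nat.add_sub_cancel, hsq]
  rcases padicValInt_eq_of_dvd hl hT hlT with ⟨hv, hd⟩ | ⟨hv, hd⟩ <;>
  · rw [hd, hv]
    field_simp
    ring

theorem pow_mul_card_GModTrace_div_card_GMod (hl : l.Prime) (hl2 : l ≠ 2) (hT : T ≠ 0)
    (hlT : (l : ℤ) ∣ T) {n : ℕ} (hn : padicValInt l T < n) :
    (l : ℚ) ^ n * (Nat.card (GModTrace (l ^ n) T) : ℚ) / (Nat.card (GMod (l ^ n)) : ℚ)
      = ((l : ℚ) ^ 6 - (l : ℚ) ^ 4 - 3 * (l : ℚ) ^ 3 + (l : ℚ))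
          / ((l : ℚ) ^ 6 - 2 * (l : ℚ) ^ 4 + (l : ℚ) ^ 2)
        + (EQuot l T + (l : ℚ) * (deltaDvd 2 (padicValInt l T) : ℚ) * ((l : ℚ) ^ 3 - 1))
          / ((l : ℚ) ^ (4 * eFloor l T + 4) * ((l : ℚ) ^ 2 - 1) ^ 2) := by
  have : Fact l.Prime := ⟨hl⟩
  have hl0 : (0 : ℚ) < l := by exact_mod_cast hl.pos
  have hm1 : (l : ℚ) - 1 ≠ 0 := sub_ne_zero.2 (by exact_mod_cast hl.one_lt.ne')
  have hsq : (l : ℚ) ^ 2 - 1 = (l - 1) * (l + 1) := by ring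
  have hden : (l : ℚ) ^ 6 - 2 * (l : ℚ) ^ 4 + (l : ℚ) ^ 2
      = (l : ℚ) ^ 2 * ((l - 1) * (l + 1)) ^ 2 := by ring
  obtain ⟨m, rfl⟩ : ∃ m, n = m + 1 := Nat.exists_eq_succ_of_ne_zero (Nat.ne_zero_of_lt hn)
  have hG := congrArg (Int.cast : ℤ → ℚ) (card_GMod_prime_pow (p := l) m.succ_ne_zero)
  push_cast at hG
  rw [card_GModTrace hl hl2 hT hlT hn, hG, zpow_six_mul_sub_eq_div hl.ne_zero, hden, hsq]
  generalize EQuot l T = E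
  generalize (deltaDvd 2 (padicValInt l T) : ℚ) = d
  field_simp
  ring

theorem den_EQuot_dvd (l : ℕ) (T : ℤ) : (EQuot l T).den ∣ (l ^ 2 + 1) * (l + 1) := by
  have h := Rat.den_dvd
    (2 * (l : ℤ) ^ 3 * ((l : ℤ) + 1) * ((l : ℤ) ^ (4 * eFloor l T + 4) - 1)
      + (l : ℤ) ^ 3 * ((l : ℤ) ^ 4 + (l : ℤ) ^ 3 + 2 * (l : ℤ) ^ 2 - (l : ℤ) - 1)
        * ((l : ℤ) ^ (4 * eFloor l T) - 1)) (((l ^ 2 + 1) * (l + 1) : ℕ) : ℤ)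
  rw [Int.natCast_dvd_natCast, Rat.divInt_eq_div] at h
  rw [EQuot]
  exact_mod_cast h

theorem not_dvd_den_EQuot (hl : l ≠ 1) (T : ℤ) : ¬l ∣ (EQuot l T).den := by
  have hcop : l.Coprime ((l ^ 2 + 1) * (l + 1)) :=
    .mul_right (by simp [sq]) (by simp)
  exact fun h => hl (hcop.eq_one_of_dvd (h.trans (den_EQuot_dvd l T)))

end ClosedForms

theorem theorem3p6 (l : ℕ) (hl : l.Prime) (hl2 : l ≠ 2) (T : ℤ) (hT : T ≠ 0)
    (hlT : (l : ℤ) ∣ T) :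
    (∀ n : ℕ, padicValInt l T + 1 ≤ n →
      (Nat.card (GModTrace (l ^ n) T) : ℚ)
        = ((l : ℚ) - 1) * (l : ℚ) ^ (6 * (n : ℤ) - 4 * (eFloor l T : ℤ) - 9)
          * ((l : ℚ) ^ (4 * eFloor l T + 3)
                * ((l : ℚ) ^ 5 - (l : ℚ) ^ 3 - 3 * (l : ℚ) ^ 2 + 1)
              + EQuot l T
              + (l : ℚ) * (deltaDvd 2 (padicValInt l T) : ℚ) * ((l : ℚ) ^ 3 - 1)))
    ∧ Tendsto
        (fun n : ℕ => (l : ℝ) ^ n * (Nat.card (GModTrace (l ^ n) T) : ℝ)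
          / (Nat.card (GMod (l ^ n)) : ℝ))
        atTop
        (𝓝 (((l : ℝ) ^ 6 - (l : ℝ) ^ 4 - 3 * (l : ℝ) ^ 3 + (l : ℝ))
              / ((l : ℝ) ^ 6 - 2 * (l : ℝ) ^ 4 + (l : ℝ) ^ 2)
            + ((EQuot l T : ℝ)
                + (l : ℝ) * (deltaDvd 2 (padicValInt l T) : ℝ) * ((l : ℝ) ^ 3 - 1))
              / ((l : ℝ) ^ (4 * eFloor l T + 4) * ((l : ℝ) ^ 2 - 1) ^ 2)))
    ∧ ¬ (l ∣ (EQuot l T).den) := by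
  refine ⟨fun n hn => card_GModTrace hl hl2 hT hlT hn, ?_, not_dvd_den_EQuot hl.ne_one T⟩
  refine tendsto_const_nhds.congr' ?_
  filter_upwards [eventually_ge_atTop (padicValInt l T + 1)] with n hn
  have hdensity := congrArg (Rat.cast : ℚ → ℝ)
    (pow_mul_card_GModTrace_div_card_GMod hl hl2 hT hlT hn)
  push_cast at hdensity
  exact hdensity.symm
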